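/- Let $X$ be a locally compact second countable Hausdorff space, let $U,V\subseteq X$ be open and let $\theta:U\to V$ be a homeomorphism. Let $\mathcal V$ be a locally trivial complex vector bundle over $U$ whose fibres have finite dimension at least one (the rank is locally constant, but need not be constant), and let $\beta$ be a Hermitian metric on $\mathcal V$, linear in the second variable. Let $\mathcal E=\Gamma_0(\mathcal V,\theta)$ be the space of continuous sections $\xi$ of $\mathcal V$ such that $x\mapsto\beta(\xi(x),\xi(x))$ vanishes at infinity on $U$, with right multiplication $(\xi f)(x)=\xi(x)f(x)$ for $f\in C_0(X)$, with the $C_0(X)$-valued inner product $\langle\xi,\eta\rangle_{\mathcal E}(x)=\beta(\xi(x),\eta(x))$ for $x\in U$ and $\langle\xi,\eta\rangle_{\mathcal E}(x)=0$ for $x\notin U$, and with left action $(\varphi_{\mathcal E}(f)\xi)(x)=\xi(x)f(\theta(x))$ for $f\in C_0(X)$. Let $\mathcal K(\mathcal E)$ denote the compact operators on $\mathcal E$, that is, the closure in operator norm, inside the adjointable operators, of the linear span of the operators $\zeta\mapsto\xi\langle\eta,\zeta\rangle_{\mathcal E}$ with $\xi,\eta\in\mathcal E$, and regard $C_0(V)$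 as the ideal of functions in $C_0(X)$ vanishing outside $V$. A Hilbert $C_0(X)$-bimodule is a space that is both a right and a left Hilbert $C_0(X)$-module (in particular complete for both norms) such that $a(\xi b)=(a\xi)b$ and ${}_{\mathcal E}\langle\xi,\eta\rangle\zeta=\xi\langle\eta,\zeta\rangle_{\mathcal E}$ for all $\xi,\eta,\zeta$ in the space and all $a,b\in C_0(X)$. Then: 1. $\varphi_{\mathcal E}(C_0(V))=\mathcal K(\mathcal E)$ if and only if $\mathcal V$ is a line bundle, that is, all its fibres have dimension one. 2. With left multiplication $f\xi=\varphi_{\mathcal E}(f)\xi$ and left inner product ${}_{\mathcal E}\langle\xi,\eta\rangle=\langle\eta,\xi\rangle_{\mathcal E}\circ\theta^{-1}$ (extended by zero outside $V$), $\mathcal E$ is a Hilbert $C_0(X)$-bimodule if and only if $\mathcal V$ is a line bundle. 3. There is some left inner product which, together with the left multiplication $f\xi=\varphi_{\mathcal E}(f)\xi$, makes $\mathcal E$ a Hilbert $C_0(X)$-bimodule if and only if $\mathcal V$ is a line bundle. -/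

import Mathlib

open Filter Topology TopologicalSpace Bundle
open scoped ZeroAtInfty

noncomputable section

/-! ### Hilbert modules over a C⋆-algebra -/

section HilbertModules

variable {A E : Type*} [NonUnitalCStarAlgebra A] [AddCommGroup E] [Module ℂ E]

/-- The norm `‖x‖ = ‖⟨x, x⟩‖^(1/2)` defined by an `A`-valued inner product. -/
def moduleNorm (ip : E → E → A) (x : E) : ℝ := √‖ip x x‖

/-- Every Cauchy sequence for `moduleNorm ip` converges. -/
def IsModuleComplete (ip : E → E → A) : Prop :=
  ∀ u : ℕ → E,
    (∀ ε > 0, ∃ N, ∀ m ≥ N, ∀ n ≥ N, moduleNorm ip (u m - u n) < ε) →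
    ∃ x, ∀ ε > 0, ∃ N, ∀ n ≥ N, moduleNorm ip (u n - x) < ε

/-- `E` is a right Hilbert `A`-module with right multiplication `ract x a = x a` and
inner product `ip`, which is linear in the second variable. -/
structure IsRightHilbertModule (ract : E → A → E) (ip : E → E → A) : Prop where
  ract_add : ∀ x a b, ract x (a + b) = ract x a + ract x b
  add_ract : ∀ x y a, ract (x + y) a = ract x a + ract y a
  ract_mul : ∀ x a b, ract x (a * b) = ract (ract x a) b
  ract_smul : ∀ (c : ℂ) x a, ract x (c • a) = c • ract x a
  smul_ract : ∀ (c : ℂ) x a, ract (c • x) a = c • ract x a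
  ip_add : ∀ x y z, ip x (y + z) = ip x y + ip x z
  ip_smul : ∀ (c : ℂ) x y, ip x (c • y) = c • ip x y
  ip_ract : ∀ x y a, ip x (ract y a) = ip x y * a
  star_ip : ∀ x y, star (ip x y) = ip y x
  ip_self_nonneg : ∀ x, ∃ a, ip x x = star a * a
  ip_definite : ∀ x, ip x x = 0 → x = 0
  complete : IsModuleComplete ip

/-- `E` is a left Hilbert `A`-module with left multiplication `lact a x = a x` and
inner product `ip`, which is linear in the first variable. -/
structure IsLeftHilbertModule (lact : A → E → E) (ip : E → E → A) : Prop where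
  add_lact : ∀ a b x, lact (a + b) x = lact a x + lact b x
  lact_add : ∀ a x y, lact a (x + y) = lact a x + lact a y
  mul_lact : ∀ a b x, lact (a * b) x = lact a (lact b x)
  smul_lact : ∀ (c : ℂ) a x, lact (c • a) x = c • lact a x
  lact_smul : ∀ (c : ℂ) a x, lact a (c • x) = c • lact a x
  add_ip : ∀ x y z, ip (x + y) z = ip x z + ip y z
  smul_ip : ∀ (c : ℂ) x y, ip (c • x) y = c • ip x y
  lact_ip : ∀ a x y, ip (lact a x) y = a * ip x y
  star_ip : ∀ x y, star (ip x y) = ip y x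
  ip_self_nonneg : ∀ x, ∃ a, ip x x = star a * a
  ip_definite : ∀ x, ip x x = 0 → x = 0
  complete : IsModuleComplete ip

/-- `E` is a Hilbert `A`-bimodule: a right and a left Hilbert `A`-module such that
`a (x b) = (a x) b` and `lip x y · z = x · rip y z`. -/
structure IsHilbertBimodule (lact : A → E → E) (lip : E → E → A)
    (ract : E → A → E) (rip : E → E → A) : Prop where
  right : IsRightHilbertModule ract rip
  left : IsLeftHilbertModule lact lip
  assoc : ∀ a x b, lact a (ract x b) = ract (lact a x) b
  compat : ∀ x y z, lact (lip x y) z = ract x (rip y z)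

/-- The operator `T` has an adjoint with respect to the inner product `ip`. -/
def IsAdjointable (ip : E → E → A) (T : E →ₗ[ℂ] E) : Prop :=
  ∃ S : E →ₗ[ℂ] E, ∀ x y, ip (T x) y = ip x (S y)

/-- The compact operators on the right Hilbert module `E`: the adjointable operators that are
limits in operator norm of linear combinations of the rank-one operators `z ↦ x ⟨y, z⟩`. -/
def compactOperators (ract : E → A → E) (ip : E → E → A) : Set (E →ₗ[ℂ] E) :=
  {T | IsAdjointable ip T ∧ ∀ ε > 0,
    ∃ F ∈ Submodule.span ℂ {R : E →ₗ[ℂ] E | ∃ x y, ∀ z, R z = ract x (ip y z)},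
      ∀ z, moduleNorm ip (T z - F z) ≤ ε * moduleNorm ip z}

end HilbertModules

/-! ### Complex vector bundles and Hermitian metrics -/

/-- A complex vector bundle over `B`. The rank is finite, at least one, and locally constant,
but it may differ between components of `B`. -/
structure ComplexVectorBundle.{u, v} (B : Type u) [TopologicalSpace B] where
  /-- The fibres. -/
  Fiber : B → Type v
  [addCommGroup : ∀ b, AddCommGroup (Fiber b)]
  [module : ∀ b, Module ℂ (Fiber b)]
  /-- The topology of the total space; the first argument of `TotalSpace` is a dummy. -/
  [topology : TopologicalSpace (TotalSpace Unit Fiber)]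
  locally_trivial : ∀ b, ∃ (n : ℕ)
    (e : Trivialization (EuclideanSpace ℂ (Fin n)) (TotalSpace.proj : TotalSpace Unit Fiber → B)),
      0 < n ∧ b ∈ e.baseSet ∧
        ∀ x ∈ e.baseSet, IsLinearMap ℂ (fun v : Fiber x ↦ (e ⟨x, v⟩).2)

attribute [instance] ComplexVectorBundle.addCommGroup ComplexVectorBundle.module
  ComplexVectorBundle.topology

namespace ComplexVectorBundle

variable {B : Type*} [TopologicalSpace B]

/-- The total space. -/
abbrev Total (𝒱 : ComplexVectorBundle B) : Type _ := TotalSpace Unit 𝒱.Fiber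

/-- All fibres are one-dimensional. -/
def IsLineBundle (𝒱 : ComplexVectorBundle B) : Prop :=
  ∀ b, Module.finrank ℂ (𝒱.Fiber b) = 1

/-- A Hermitian metric: an inner product on each fibre (linear in the second variable) that is
continuous on the total space of the Whitney sum `𝒱 ⊕ 𝒱`. -/
structure HermitianMetric (𝒱 : ComplexVectorBundle B) where
  /-- The inner product on each fibre. -/
  core : ∀ b, InnerProductSpace.Core ℂ (𝒱.Fiber b)
  continuous_inner : Continuous
    (fun q : TotalSpace (Unit × Unit) (𝒱.Fiber ×ᵇ 𝒱.Fiber) ↦ (core q.1).inner q.2.1 q.2.2)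

/-- The value `β(v, w)`. -/
def HermitianMetric.ip {𝒱 : ComplexVectorBundle B} (β : 𝒱.HermitianMetric) {b : B}
    (v w : 𝒱.Fiber b) : ℂ := (β.core b).inner v w

variable {𝒱 : ComplexVectorBundle B}

/-- A section, seen as a map into the total space. -/
def sec (ξ : ∀ b, 𝒱.Fiber b) (b : B) : 𝒱.Total := ⟨b, ξ b⟩

theorem continuousAt_sec_iff {n : ℕ}
    (e : Trivialization (EuclideanSpace ℂ (Fin n)) (TotalSpace.proj : 𝒱.Total → B))
    {b : B} (hb : b ∈ e.baseSet) (ξ : ∀ b, 𝒱.Fiber b) :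
    ContinuousAt (sec ξ) b ↔ ContinuousAt (fun x ↦ (e (sec ξ x)).2) b := by
  have hsrc : sec ξ b ∈ e.source := e.mem_source.2 hb
  constructor
  · intro h
    exact continuousAt_snd.comp (ContinuousAt.comp (e.continuousAt hsrc) h)
  · intro h
    refine e.continuousAt_of_comp_left (f := sec ξ) continuousAt_id hb ?_
    have h2 : ContinuousAt (fun x ↦ (x, (e (sec ξ x)).2)) b := continuousAt_id.prodMk h
    refine h2.congr ?_
    filter_upwards [e.open_baseSet.mem_nhds hb] with x hx
    exact Prod.ext (e.coe_fst (e.mem_source.2 (show (sec ξ x).proj ∈ e.baseSet from hx))).symm rfl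

theorem continuous_sec_add {ξ η : ∀ b, 𝒱.Fiber b} (hξ : Continuous (sec ξ))
    (hη : Continuous (sec η)) : Continuous (sec (ξ + η)) := by
  refine continuous_iff_continuousAt.2 fun b ↦ ?_
  obtain ⟨n, e, -, hb, hlin⟩ := 𝒱.locally_trivial b
  have h1 := (continuousAt_sec_iff e hb ξ).1 hξ.continuousAt
  have h2 := (continuousAt_sec_iff e hb η).1 hη.continuousAt
  refine (continuousAt_sec_iff e hb _).2 ((h1.add h2).congr ?_)
  filter_upwards [e.open_baseSet.mem_nhds hb] with x hx
  exact ((hlin x hx).map_add (ξ x) (η x)).symm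

theorem continuous_sec_smul {f : B → ℂ} {ξ : ∀ b, 𝒱.Fiber b} (hf : Continuous f)
    (hξ : Continuous (sec ξ)) : Continuous (sec (fun b ↦ f b • ξ b)) := by
  refine continuous_iff_continuousAt.2 fun b ↦ ?_
  obtain ⟨n, e, -, hb, hlin⟩ := 𝒱.locally_trivial b
  have h1 := (continuousAt_sec_iff e hb ξ).1 hξ.continuousAt
  refine (continuousAt_sec_iff e hb _).2 ((hf.continuousAt.smul h1).congr ?_)
  filter_upwards [e.open_baseSet.mem_nhds hb] with x hx
  exact ((hlin x hx).map_smul (f x) (ξ x)).symm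

theorem continuous_sec_zero : Continuous (sec (0 : ∀ b, 𝒱.Fiber b)) := by
  refine continuous_iff_continuousAt.2 fun b ↦ ?_
  obtain ⟨n, e, -, hb, hlin⟩ := 𝒱.locally_trivial b
  refine (continuousAt_sec_iff e hb _).2
    ((continuousAt_const (y := (0 : EuclideanSpace ℂ (Fin n)))).congr ?_)
  filter_upwards [e.open_baseSet.mem_nhds hb] with x hx
  exact ((hlin x hx).map_zero).symm

namespace HermitianMetric

variable (β : 𝒱.HermitianMetric)

theorem continuous_ip {ξ η : ∀ b, 𝒱.Fiber b} (hξ : Continuous (sec ξ))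
    (hη : Continuous (sec η)) : Continuous (fun b ↦ β.ip (ξ b) (η b)) := by
  have h : Continuous (fun b ↦
      (⟨b, (ξ b, η b)⟩ : TotalSpace (Unit × Unit) (𝒱.Fiber ×ᵇ 𝒱.Fiber))) :=
    (FiberBundle.Prod.isInducing_diag Unit 𝒱.Fiber Unit 𝒱.Fiber).continuous_iff.2
      (hξ.prodMk hη)
  exact β.continuous_inner.comp h

theorem norm_ip_le {b : B} (v w : 𝒱.Fiber b) :
    ‖β.ip v w‖ ≤ ‖β.ip v v‖ + ‖β.ip w w‖ := by
  let := β.core b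
  let : NormedAddCommGroup (𝒱.Fiber b) := (β.core b).toNormedAddCommGroup
  let : InnerProductSpace ℂ (𝒱.Fiber b) := InnerProductSpace.ofCore (β.core b).toCore
  change ‖inner ℂ v w‖ ≤ ‖inner ℂ v v‖ + ‖inner ℂ w w‖
  have h := norm_inner_le_norm (𝕜 := ℂ) v w
  rw [inner_self_eq_norm_sq_to_K, inner_self_eq_norm_sq_to_K]
  simp only [norm_pow, Complex.coe_algebraMap, Complex.norm_real, norm_norm]
  nlinarith [sq_nonneg (‖v‖ - ‖w‖), sq_nonneg ‖v‖, sq_nonneg ‖w‖]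

theorem norm_ip_add_le {b : B} (v w : 𝒱.Fiber b) :
    ‖β.ip (v + w) (v + w)‖ ≤ 3 * (‖β.ip v v‖ + ‖β.ip w w‖) := by
  have h : β.ip (v + w) (v + w) = β.ip v v + β.ip v w + (β.ip w v + β.ip w w) := by
    let := β.core b
    let : NormedAddCommGroup (𝒱.Fiber b) := (β.core b).toNormedAddCommGroup
    let : InnerProductSpace ℂ (𝒱.Fiber b) := InnerProductSpace.ofCore (β.core b).toCore
    change inner ℂ (v + w) (v + w) = inner ℂ v v + inner ℂ v w + (inner ℂ w v + inner ℂ w w)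
    rw [inner_add_left, inner_add_right, inner_add_right]
  rw [h]
  have h1 := β.norm_ip_le v w
  have h2 := β.norm_ip_le w v
  calc _ ≤ ‖β.ip v v + β.ip v w‖ + ‖β.ip w v + β.ip w w‖ := norm_add_le _ _
    _ ≤ (‖β.ip v v‖ + ‖β.ip v w‖) + (‖β.ip w v‖ + ‖β.ip w w‖) :=
      add_le_add (norm_add_le _ _) (norm_add_le _ _)
    _ ≤ _ := by linarith

theorem ip_smul_smul {b : B} (c : ℂ) (v : 𝒱.Fiber b) :
    β.ip (c • v) (c • v) = (‖c‖ ^ 2 : ℝ) * β.ip v v := by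
  let := β.core b
  let : NormedAddCommGroup (𝒱.Fiber b) := (β.core b).toNormedAddCommGroup
  let : InnerProductSpace ℂ (𝒱.Fiber b) := InnerProductSpace.ofCore (β.core b).toCore
  change inner ℂ (c • v) (c • v) = (‖c‖ ^ 2 : ℝ) * inner ℂ v v
  rw [inner_smul_left, inner_smul_right, ← mul_assoc, Complex.conj_mul']
  push_cast
  rfl

theorem tendsto_ip_smul {f : B → ℂ} {C : ℝ} (hf : ∀ b, ‖f b‖ ≤ C) {ξ : ∀ b, 𝒱.Fiber b}
    (hξ : Tendsto (fun b ↦ β.ip (ξ b) (ξ b)) (cocompact B) (𝓝 0)) :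
    Tendsto (fun b ↦ β.ip (f b • ξ b) (f b • ξ b)) (cocompact B) (𝓝 0) := by
  have h := (tendsto_zero_iff_norm_tendsto_zero.1 hξ).const_mul (C ^ 2)
  rw [mul_zero] at h
  refine squeeze_zero_norm (fun b ↦ ?_) h
  rw [ip_smul_smul, norm_mul, Complex.norm_real, Real.norm_of_nonneg (by positivity)]
  gcongr
  exact hf b

/-- The space `Γ₀(𝒱)` of continuous sections of `𝒱` vanishing at infinity with respect to `β`. -/
def sections : Submodule ℂ (∀ b, 𝒱.Fiber b) where
  carrier := {ξ | Continuous (sec ξ) ∧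
    Tendsto (fun b ↦ β.ip (ξ b) (ξ b)) (cocompact B) (𝓝 0)}
  add_mem' := by
    rintro ξ η ⟨hξ, hξ'⟩ ⟨hη, hη'⟩
    refine ⟨continuous_sec_add hξ hη, ?_⟩
    have h := ((tendsto_zero_iff_norm_tendsto_zero.1 hξ').add
      (tendsto_zero_iff_norm_tendsto_zero.1 hη')).const_mul 3
    rw [add_zero, mul_zero] at h
    exact squeeze_zero_norm (fun b ↦ β.norm_ip_add_le (ξ b) (η b)) h
  zero_mem' := by
    refine ⟨continuous_sec_zero, ?_⟩
    have h : ∀ b, β.ip ((0 : ∀ b, 𝒱.Fiber b) b) ((0 : ∀ b, 𝒱.Fiber b) b) = 0 := fun b ↦ by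
      simpa using β.ip_smul_smul (b := b) 0 0
    simp only [h]
    exact tendsto_const_nhds
  smul_mem' := by
    rintro c ξ ⟨hξ, hξ'⟩
    exact ⟨continuous_sec_smul continuous_const hξ, β.tendsto_ip_smul (fun _ ↦ le_rfl) hξ'⟩

/-- The product of a section in `Γ₀(𝒱)` with a bounded continuous function. -/
def mulSection (f : BoundedContinuousFunction B ℂ) : β.sections →ₗ[ℂ] β.sections where
  toFun ξ := ⟨fun b ↦ f b • ξ.1 b, continuous_sec_smul f.continuous ξ.2.1,
    β.tendsto_ip_smul f.norm_coe_le_norm ξ.2.2⟩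
  map_add' ξ η := Subtype.ext <| funext fun b ↦ smul_add (f b) (ξ.1 b) (η.1 b)
  map_smul' c ξ := Subtype.ext <| funext fun b ↦ smul_comm (f b) c (ξ.1 b)

/-- The function `b ↦ β(ξ(b), η(b))`, which vanishes at infinity on `B`. -/
def baseInner (ξ η : β.sections) : C₀(B, ℂ) where
  toFun b := β.ip (ξ.1 b) (η.1 b)
  continuous_toFun := β.continuous_ip ξ.2.1 η.2.1
  zero_at_infty' := by
    have h := (tendsto_zero_iff_norm_tendsto_zero.1 ξ.2.2).add
      (tendsto_zero_iff_norm_tendsto_zero.1 η.2.2)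
    rw [add_zero] at h
    exact squeeze_zero_norm (fun b ↦ β.norm_ip_le (ξ.1 b) (η.1 b)) h

end HermitianMetric

end ComplexVectorBundle

/-! ### Functions vanishing at infinity on open subsets -/

section ExtendZero

variable {X : Type*} [TopologicalSpace X]

open Classical in
/-- The extension by zero of a function on an open subset. -/
def zeroExtension (U : Opens X) (g : U → ℂ) (x : X) : ℂ :=
  if h : x ∈ U then g ⟨x, h⟩ else 0

theorem exists_compact_zeroExtension (U : Opens X) (g : C₀(U, ℂ)) {ε : ℝ} (hε : 0 < ε) :
    ∃ K : Set X, IsCompact K ∧ K ⊆ U ∧ ∀ x ∉ K, ‖zeroExtension U g x‖ < ε := by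
  have h := (tendsto_zero_iff_norm_tendsto_zero.1 g.zero_at_infty').eventually (gt_mem_nhds hε)
  obtain ⟨K, hK, hsub⟩ := mem_cocompact.1 h
  refine ⟨Subtype.val '' K, hK.image continuous_subtype_val, ?_, fun x hx ↦ ?_⟩
  · rintro _ ⟨y, -, rfl⟩
    exact y.2
  · unfold zeroExtension
    split_ifs with hU
    · exact hsub fun hmem ↦ hx ⟨⟨x, hU⟩, hmem, rfl⟩
    · simpa using hε

variable [T2Space X]

/-- The inclusion `C₀(U) → C₀(X)` given by extension by zero, for `U` open in `X`. -/
def extendZero (U : Opens X) (g : C₀(U, ℂ)) : C₀(X, ℂ) where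
  toFun := zeroExtension U g
  continuous_toFun := by
    refine continuous_iff_continuousAt.2 fun x ↦ ?_
    by_cases hx : x ∈ U
    · refine (U.isOpen.isOpenEmbedding_subtypeVal.continuousAt_iff (x := ⟨x, hx⟩)).1 ?_
      refine g.continuous.continuousAt.congr (Eventually.of_forall fun y ↦ ?_)
      simp [zeroExtension]
    · have h0 : zeroExtension U g x = 0 := by simp [zeroExtension, hx]
      rw [ContinuousAt, h0, Metric.tendsto_nhds]
      intro ε hε
      obtain ⟨K, hK, hKU, hlt⟩ := exists_compact_zeroExtension U g hε
      filter_upwards [hK.isClosed.isOpen_compl.mem_nhds fun h ↦ hx (hKU h)] with y hy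
      simpa using hlt y hy
  zero_at_infty' := by
    rw [Metric.tendsto_nhds]
    intro ε hε
    obtain ⟨K, hK, -, hlt⟩ := exists_compact_zeroExtension U g hε
    filter_upwards [hK.compl_mem_cocompact] with y hy
    simpa using hlt y hy

/-- The ideal `C₀(V)` of `C₀(X)`, for `V` open in `X`: the functions vanishing outside `V`. -/
def idealOfOpen (V : Opens X) : Set C₀(X, ℂ) := {f | ∀ x ∉ V, f x = 0}

end ExtendZero

/-! ### The correspondence of a partial automorphism and a vector bundle -/

namespace Correspondence

variable {X : Type*} [TopologicalSpace X] {U V : Opens X} {𝒱 : ComplexVectorBundle U}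

/-- The right multiplication `(ξ f)(x) = ξ(x) f(x)` of `C₀(X)` on `Γ₀(𝒱)`. -/
def rightMul (β : 𝒱.HermitianMetric) (ξ : β.sections) (f : C₀(X, ℂ)) : β.sections :=
  β.mulSection (f.toBCF.compContinuous ⟨Subtype.val, continuous_subtype_val⟩) ξ

/-- The structure map `(φ(f) ξ)(x) = ξ(x) f(θ(x))`. -/
def structureMap (θ : U ≃ₜ V) (β : 𝒱.HermitianMetric) (f : C₀(X, ℂ)) :
    β.sections →ₗ[ℂ] β.sections :=
  β.mulSection
    (f.toBCF.compContinuous ⟨fun x ↦ (θ x : X), continuous_subtype_val.comp θ.continuous⟩)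

/-- The left multiplication `f ξ = φ(f) ξ`. -/
def leftMul (θ : U ≃ₜ V) (β : 𝒱.HermitianMetric) (f : C₀(X, ℂ)) (ξ : β.sections) : β.sections :=
  structureMap θ β f ξ

variable [T2Space X]

/-- The `C₀(X)`-valued inner product `⟨ξ, η⟩(x) = β(ξ(x), η(x))`, zero outside `U`. -/
def rightInner (β : 𝒱.HermitianMetric) (ξ η : β.sections) : C₀(X, ℂ) :=
  extendZero U (β.baseInner ξ η)

/-- The function `⟨η, ξ⟩ ∘ θ⁻¹` on `V`, zero outside `V`. -/
def leftInner (θ : U ≃ₜ V) (β : 𝒱.HermitianMetric) (ξ η : β.sections) : C₀(X, ℂ) :=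
  extendZero V ((β.baseInner η ξ).comp θ.symm.toCocompactMap)

end Correspondence

end

/-! Everything reduces to linear algebra in one fibre. The structure map acts on each fibre by
scalars, while the rank-one operator of `x`, `y` acts at `t` by `z ↦ β(y(t), z) x(t)`. Since
sections take every value at a given point, all rank-one operators can be multiplication operators
only if every `z ↦ β(v, z) w` is a scalar; taking `z = v` of length one makes `w` a multiple of `v`,
so the fibre is a line. Each of the three conditions puts the rank-one operators in the image of the
structure map: in 1 because they are compact, in 2 and 3 by the compatibility of the two inner
products.

Conversely, on a line `β(v, w) u = β(v, u) w`. This identity is exactly the compatibility axiom, and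
it turns finite-rank operators into multiplications by functions in `C₀(U)`. Operator-norm limits
stay of this form because the operator norm of a multiplication is the sup norm, and `C₀(U)` is
complete; through `θ` such functions correspond to `C₀(V)`. In the other direction,
`structureMap_mem_compactOperators` approximates a multiplication by finite sums of rank-one
operators.

Completeness for either inner product is uniform completeness of sections: fibres are
finite-dimensional and `β` dominates the norm of a local trivialization locally uniformly, so
uniform limits are continuous. -/

namespace ComplexVectorBundle

variable {B : Type*} [TopologicalSpace B] {𝒱 : ComplexVectorBundle B}

/-! ### Local trivializations -/

theorem exists_trivialization_eq {n : ℕ}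
    (e : Trivialization (EuclideanSpace ℂ (Fin n)) (TotalSpace.proj : 𝒱.Total → B))
    {b : B} (hb : b ∈ e.baseSet) (y : EuclideanSpace ℂ (Fin n)) :
    ∃ v : 𝒱.Fiber b, e ⟨b, v⟩ = (b, y) ∧ e.toOpenPartialHomeomorph.symm (b, y) = ⟨b, v⟩ := by
  have ht : (b, y) ∈ e.target := e.mem_target.2 hb
  have h1 : e (e.toOpenPartialHomeomorph.symm (b, y)) = (b, y) := e.apply_symm_apply ht
  have h2 : (e.toOpenPartialHomeomorph.symm (b, y)).proj = b := e.proj_symm_apply ht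
  -- Once the preimage is an arbitrary point of the total space, its base point can be substituted
  -- by `b`, so its vector needs no transport between fibres.
  revert h1 h2
  generalize e.toOpenPartialHomeomorph.symm (b, y) = z
  rcases z with ⟨b', v⟩
  rintro h1 (rfl : b' = b)
  exact ⟨v, h1, rfl⟩

/-- The linear isomorphism of a fibre with the model space given by a fibrewise linear
trivialization. -/
noncomputable def fiberEquiv {n : ℕ}
    (e : Trivialization (EuclideanSpace ℂ (Fin n)) (TotalSpace.proj : 𝒱.Total → B))
    {b : B} (hb : b ∈ e.baseSet) (hlin : IsLinearMap ℂ (fun v : 𝒱.Fiber b ↦ (e ⟨b, v⟩).2)) :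
    𝒱.Fiber b ≃ₗ[ℂ] EuclideanSpace ℂ (Fin n) :=
  LinearEquiv.ofBijective hlin.mk' <| by
    constructor
    · intro v w h
      have hv : (⟨b, v⟩ : 𝒱.Total) ∈ e.source := e.mem_source.2 hb
      have hw : (⟨b, w⟩ : 𝒱.Total) ∈ e.source := e.mem_source.2 hb
      have h' : e (⟨b, v⟩ : 𝒱.Total) = e ⟨b, w⟩ :=
        Prod.ext ((e.coe_fst hv).trans (e.coe_fst hw).symm) h
      have h2 := e.injOn hv hw h'
      simpa using h2
    · intro y
      obtain ⟨v, hv, -⟩ := exists_trivialization_eq e hb y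
      exact ⟨v, congrArg Prod.snd hv⟩

theorem fiberEquiv_apply {n : ℕ}
    (e : Trivialization (EuclideanSpace ℂ (Fin n)) (TotalSpace.proj : 𝒱.Total → B))
    {b : B} (hb : b ∈ e.baseSet) (hlin : IsLinearMap ℂ (fun v : 𝒱.Fiber b ↦ (e ⟨b, v⟩).2))
    (v : 𝒱.Fiber b) : fiberEquiv e hb hlin v = (e ⟨b, v⟩).2 := rfl

instance finiteDimensional_fiber (b : B) : FiniteDimensional ℂ (𝒱.Fiber b) := by
  obtain ⟨n, e, -, hb, hlin⟩ := 𝒱.locally_trivial b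
  exact (fiberEquiv e hb (hlin b hb)).symm.finiteDimensional

theorem nontrivial_fiber (b : B) : Nontrivial (𝒱.Fiber b) := by
  obtain ⟨n, e, hn, hb, hlin⟩ := 𝒱.locally_trivial b
  have : Nonempty (Fin n) := ⟨⟨0, hn⟩⟩
  exact (fiberEquiv e hb (hlin b hb)).toEquiv.nontrivial

open Classical in
/-- A section with compact support in a trivializing open set through a given vector. -/
theorem exists_sec_eq [T2Space B] [LocallyCompactSpace B] (b : B) (v : 𝒱.Fiber b) :
    ∃ ξ : ∀ x, 𝒱.Fiber x, Continuous (sec ξ) ∧ ξ b = v ∧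
      ∃ K : Set B, IsCompact K ∧ ∀ x ∉ K, ξ x = 0 := by
  obtain ⟨n, e, -, hb, hlin⟩ := 𝒱.locally_trivial b
  obtain ⟨L, hL, hbL, hLe⟩ := exists_compact_subset e.open_baseSet hb
  obtain ⟨χ, hχ1, hχ0, -⟩ := exists_continuous_one_zero_of_isCompact
    (isCompact_singleton (x := b)) (isClosed_compl_iff.2 (isOpen_interior (s := L)))
    (by simpa using hbL)
  let y := (e (⟨b, v⟩ : 𝒱.Total)).2
  -- A constant section in the trivialization, cut off by a bump function supported in `L`.
  let ξ : ∀ x, 𝒱.Fiber x := fun x ↦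
    if hx : x ∈ e.baseSet then (χ x : ℂ) • (fiberEquiv e hx (hlin x hx)).symm y else 0
  have hzero : ∀ x ∉ L, ξ x = 0 := by
    intro x hx
    have h0 : χ x = 0 := hχ0 fun h ↦ hx (interior_subset h)
    by_cases hxe : x ∈ e.baseSet <;> simp [ξ, hxe, h0]
  refine ⟨ξ, continuous_iff_continuousAt.2 fun x ↦ ?_, ?_, L, hL, hzero⟩
  · by_cases hx : x ∈ e.baseSet
    · refine (continuousAt_sec_iff e hx ξ).2 ?_
      have hc : ContinuousAt (fun x ↦ (χ x : ℂ) • y) x := by fun_prop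
      refine hc.congr ?_
      filter_upwards [e.open_baseSet.mem_nhds hx] with z hz
      have : (e (sec ξ z)).2 = fiberEquiv e hz (hlin z hz) (ξ z) := rfl
      rw [this]
      simp only [ξ, dif_pos hz, map_smul, LinearEquiv.apply_symm_apply]
    · have hxL : x ∉ L := fun h ↦ hx (hLe h)
      refine (continuous_sec_zero (𝒱 := 𝒱)).continuousAt.congr ?_
      filter_upwards [hL.isClosed.isOpen_compl.mem_nhds hxL] with z hz
      simp [sec, hzero z hz]
  · have h1 : χ b = 1 := hχ1 rfl
    simp only [ξ, dif_pos hb, h1, y, ← fiberEquiv_apply e hb (hlin b hb)]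
    simp

namespace HermitianMetric

variable (β : 𝒱.HermitianMetric)

/-! ### The norm on the fibres -/

/-- The fibre at `b` as a normed space. -/
noncomputable abbrev fiberNormedAddCommGroup (b : B) : NormedAddCommGroup (𝒱.Fiber b) :=
  (β.core b).toNormedAddCommGroup

/-- The fibre at `b` as an inner product space. -/
noncomputable abbrev fiberInnerProductSpace (b : B) :
    letI := β.fiberNormedAddCommGroup b
    InnerProductSpace ℂ (𝒱.Fiber b) :=
  letI := β.fiberNormedAddCommGroup b
  InnerProductSpace.ofCore (β.core b).toCore

/-- The length of a vector. -/
noncomputable def len {b : B} (v : 𝒱.Fiber b) : ℝ := √‖β.ip v v‖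

/-- The normed structure on a fibre depends on `β` and is only a local instance; `len` carries the
norm facts across without it. -/
theorem len_eq_norm {b : B} (v : 𝒱.Fiber b) :
    β.len v = (β.fiberNormedAddCommGroup b).toNorm.norm v := by
  let := β.fiberNormedAddCommGroup b
  let := β.fiberInnerProductSpace b
  have h : β.ip v v = inner ℂ v v := rfl
  rw [len, h, inner_self_eq_norm_sq_to_K]
  simp

theorem len_nonneg {b : B} (v : 𝒱.Fiber b) : 0 ≤ β.len v := Real.sqrt_nonneg _

theorem len_add_le {b : B} (v w : 𝒱.Fiber b) : β.len (v + w) ≤ β.len v + β.len w := by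
  let := β.fiberNormedAddCommGroup b
  simp only [len_eq_norm]
  exact norm_add_le v w

theorem len_sub_rev {b : B} (v w : 𝒱.Fiber b) : β.len (v - w) = β.len (w - v) := by
  let := β.fiberNormedAddCommGroup b
  simp only [len_eq_norm]
  exact norm_sub_rev v w

theorem len_sub_le_add {b : B} (u v w : 𝒱.Fiber b) :
    β.len (u - w) ≤ β.len (u - v) + β.len (v - w) := by
  have := β.len_add_le (u - v) (v - w)
  rwa [sub_add_sub_cancel] at this

theorem len_smul {b : B} (c : ℂ) (v : 𝒱.Fiber b) : β.len (c • v) = ‖c‖ * β.len v := by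
  let := β.fiberNormedAddCommGroup b
  let := β.fiberInnerProductSpace b
  simp only [len_eq_norm]
  exact norm_smul c v

theorem len_eq_zero {b : B} {v : 𝒱.Fiber b} : β.len v = 0 ↔ v = 0 := by
  let := β.fiberNormedAddCommGroup b
  simp only [len_eq_norm]
  exact norm_eq_zero

theorem len_sq {b : B} (v : 𝒱.Fiber b) : β.len v ^ 2 = ‖β.ip v v‖ :=
  Real.sq_sqrt (norm_nonneg _)

theorem ip_self_eq {b : B} (v : 𝒱.Fiber b) : β.ip v v = ((β.len v ^ 2 : ℝ) : ℂ) := by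
  let := β.fiberNormedAddCommGroup b
  let := β.fiberInnerProductSpace b
  simp only [len_eq_norm]
  have h : β.ip v v = inner ℂ v v := rfl
  rw [h, inner_self_eq_norm_sq_to_K]
  simp

theorem ip_add_right {b : B} (u v w : 𝒱.Fiber b) : β.ip u (v + w) = β.ip u v + β.ip u w := by
  let := β.fiberNormedAddCommGroup b
  let := β.fiberInnerProductSpace b
  exact inner_add_right (𝕜 := ℂ) u v w

theorem ip_smul_right {b : B} (c : ℂ) (v w : 𝒱.Fiber b) : β.ip v (c • w) = c * β.ip v w := by
  let := β.fiberNormedAddCommGroup b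
  let := β.fiberInnerProductSpace b
  exact inner_smul_right (𝕜 := ℂ) v w c

theorem star_ip {b : B} (v w : 𝒱.Fiber b) : star (β.ip v w) = β.ip w v := by
  let := β.fiberNormedAddCommGroup b
  let := β.fiberInnerProductSpace b
  exact inner_conj_symm (𝕜 := ℂ) w v

theorem ip_smul_left {b : B} (c : ℂ) (v w : 𝒱.Fiber b) :
    β.ip (c • v) w = star c * β.ip v w := by
  rw [← star_ip, ip_smul_right, star_mul', star_ip]

theorem ip_self_eq_zero {b : B} {v : 𝒱.Fiber b} : β.ip v v = 0 ↔ v = 0 := by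
  rw [ip_self_eq, ← β.len_eq_zero]
  simp

/-- Cauchy sequences in a fibre converge. -/
theorem exists_tendsto_of_cauchy {b : B} (u : ℕ → 𝒱.Fiber b)
    (hu : ∀ ε > 0, ∃ N, ∀ m ≥ N, ∀ n ≥ N, β.len (u m - u n) < ε) :
    ∃ v, ∀ ε > 0, ∃ N, ∀ n ≥ N, β.len (u n - v) < ε := by
  let := β.fiberNormedAddCommGroup b
  let := β.fiberInnerProductSpace b
  have : CompleteSpace (𝒱.Fiber b) := FiniteDimensional.complete ℂ _
  simp only [len_eq_norm] at hu ⊢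
  have hc : CauchySeq u := Metric.cauchySeq_iff.2 fun ε hε ↦ by
    simpa only [dist_eq_norm] using hu ε hε
  obtain ⟨v, hv⟩ := cauchySeq_tendsto_of_complete hc
  refine ⟨v, fun ε hε ↦ ?_⟩
  simpa only [dist_eq_norm] using Metric.tendsto_atTop.1 hv ε hε

theorem continuous_len {ξ : ∀ b, 𝒱.Fiber b} (hξ : Continuous (sec ξ)) :
    Continuous (fun b ↦ β.len (ξ b)) :=
  (β.continuous_ip hξ hξ).norm.sqrt

theorem continuous_len_total : Continuous (fun z : 𝒱.Total ↦ β.len z.2) := by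
  have h : Continuous (fun z : 𝒱.Total ↦
      (⟨z.1, (z.2, z.2)⟩ : TotalSpace (Unit × Unit) (𝒱.Fiber ×ᵇ 𝒱.Fiber))) :=
    (FiberBundle.Prod.isInducing_diag Unit 𝒱.Fiber Unit 𝒱.Fiber).continuous_iff.2
      (continuous_id.prodMk continuous_id)
  exact (β.continuous_inner.comp h).norm.sqrt

/-- Near every point the norm in a trivialization is dominated by the norm of `β`. -/
theorem exists_norm_trivialization_le {n : ℕ}
    (e : Trivialization (EuclideanSpace ℂ (Fin n)) (TotalSpace.proj : 𝒱.Total → B))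
    {b : B} (hb : b ∈ e.baseSet)
    (hlin : ∀ x ∈ e.baseSet, IsLinearMap ℂ (fun v : 𝒱.Fiber x ↦ (e ⟨x, v⟩).2)) :
    ∃ C > 0, ∀ᶠ x in 𝓝 b, ∀ v : 𝒱.Fiber x, ‖(e ⟨x, v⟩).2‖ ≤ C * β.len v := by
  -- `N` is the length read in coordinates. It is positive on the unit sphere over `b`, hence at
  -- least some `m > 0` there; compactness of the sphere keeps it above `m / 2` over nearby points,
  -- and homogeneity gives the constant `2 / m`.
  let N : B × EuclideanSpace ℂ (Fin n) → ℝ :=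
    fun q ↦ β.len (e.toOpenPartialHomeomorph.symm q).2
  have hN : ∀ y, ContinuousAt N (b, y) := fun y ↦
    β.continuous_len_total.continuousAt.comp
      (e.toOpenPartialHomeomorph.continuousAt_symm (e.mem_target.2 hb))
  have hNv : ∀ x ∈ e.baseSet, ∀ v : 𝒱.Fiber x, N (x, (e ⟨x, v⟩).2) = β.len v := by
    intro x hx v
    have h : e.toOpenPartialHomeomorph.symm (x, (e ⟨x, v⟩).2) = ⟨x, v⟩ :=
      e.symm_apply_mk_proj (x := (⟨x, v⟩ : 𝒱.Total)) (e.mem_source.2 hx)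
    simp only [N]
    rw [h]
  have hpos : ∀ y ∈ Metric.sphere (0 : EuclideanSpace ℂ (Fin n)) 1, 0 < N (b, y) := by
    intro y hy
    obtain ⟨v, rfl⟩ := (fiberEquiv e hb (hlin b hb)).surjective y
    rw [fiberEquiv_apply, hNv b hb]
    refine (β.len_nonneg v).lt_of_ne' fun h ↦ ?_
    rw [β.len_eq_zero.1 h, map_zero] at hy
    simp at hy
  have hS := isCompact_sphere (0 : EuclideanSpace ℂ (Fin n)) 1
  obtain ⟨m, hm, hmN⟩ := hS.exists_forall_le' (f := fun y ↦ N (b, y))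
    (fun y _ ↦ ((hN y).comp (by fun_prop : ContinuousAt (fun y ↦ (b, y)) y)).continuousWithinAt)
    hpos
  have hev : ∀ᶠ x in 𝓝 b, ∀ y ∈ Metric.sphere (0 : EuclideanSpace ℂ (Fin n)) 1,
      m / 2 < N (x, y) := by
    refine hS.eventually_forall_of_forall_eventually fun y hy ↦ ?_
    exact (hN y).eventually (lt_mem_nhds (by linarith [hmN y hy]))
  refine ⟨2 / m, by positivity, ?_⟩
  filter_upwards [hev, e.open_baseSet.mem_nhds hb] with x hx hxe v
  by_cases h0 : (e ⟨x, v⟩).2 = 0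
  · rw [h0, norm_zero]
    exact mul_nonneg (by positivity) (β.len_nonneg v)
  have hr : 0 < ‖(e (⟨x, v⟩ : 𝒱.Total)).2‖ := norm_pos_iff.2 h0
  set c : ℂ := ((‖(e (⟨x, v⟩ : 𝒱.Total)).2‖⁻¹ : ℝ) : ℂ)
  have hc : ‖c‖ = ‖(e (⟨x, v⟩ : 𝒱.Total)).2‖⁻¹ := by
    rw [Complex.norm_real, Real.norm_of_nonneg (inv_pos.2 hr).le]
  have h1 := hx (c • (e ⟨x, v⟩).2) (by
    rw [mem_sphere_zero_iff_norm, norm_smul, hc, inv_mul_cancel₀ hr.ne'])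
  rw [← (hlin x hxe).map_smul, hNv x hxe, len_smul, hc, inv_mul_eq_div, lt_div_iff₀ hr] at h1
  rw [div_mul_eq_mul_div, le_div_iff₀ hm]
  linarith

/-! ### Sections vanishing at infinity -/

theorem exists_section_eq [T2Space B] [LocallyCompactSpace B] (b : B) (v : 𝒱.Fiber b) :
    ∃ ξ : β.sections, ξ.1 b = v := by
  obtain ⟨ξ, hξ, hv, K, hK, h0⟩ := exists_sec_eq b v
  refine ⟨⟨ξ, hξ, ?_⟩, hv⟩
  refine (tendsto_const_nhds (x := (0 : ℂ))).congr' ?_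
  filter_upwards [hK.compl_mem_cocompact] with x hx
  exact ((β.ip_self_eq_zero).2 (h0 x hx)).symm

/-- A vector of length one is the value of a section in the unit ball. -/
theorem exists_section_eq_le_one [T2Space B] [LocallyCompactSpace B] (b : B) (v : 𝒱.Fiber b)
    (hv : β.len v = 1) : ∃ ξ : β.sections, ξ.1 b = v ∧ ∀ x, β.len (ξ.1 x) ≤ 1 := by
  obtain ⟨ξ, hξ⟩ := β.exists_section_eq b v
  have hpos : ∀ x, 0 < max 1 (β.len (ξ.1 x)) := fun x ↦ lt_max_of_lt_left one_pos
  -- Dividing by `max 1 |ξ|` bounds all lengths by one and leaves the value at `b` alone, as it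
  -- already has length one.
  let f : BoundedContinuousFunction B ℂ := BoundedContinuousFunction.ofNormedAddCommGroup
    (fun x ↦ (((max 1 (β.len (ξ.1 x)))⁻¹ : ℝ) : ℂ))
    (Complex.continuous_ofReal.comp
      ((continuous_const.max (β.continuous_len ξ.2.1)).inv₀ fun x ↦ (hpos x).ne')) 1
    (fun x ↦ by
      rw [Complex.norm_real, Real.norm_of_nonneg (inv_pos.2 (hpos x)).le]
      exact inv_le_one_of_one_le₀ (le_max_left _ _))
  refine ⟨β.mulSection f ξ, ?_, fun x ↦ ?_⟩
  · change f b • ξ.1 b = v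
    simp [f, hξ, hv]
  · change β.len (f x • ξ.1 x) ≤ 1
    rw [len_smul]
    simp only [f, BoundedContinuousFunction.coe_ofNormedAddCommGroup]
    rw [Complex.norm_real, Real.norm_of_nonneg (inv_pos.2 (hpos x)).le,
      inv_mul_le_iff₀ (hpos x), mul_one]
    exact le_max_right _ _

end HermitianMetric

end ComplexVectorBundle

/-! ### Completeness of the space of sections -/

namespace ComplexVectorBundle.HermitianMetric

variable {B : Type*} [TopologicalSpace B] {𝒱 : ComplexVectorBundle B} (β : 𝒱.HermitianMetric)

theorem tendsto_ip_self_iff {ξ : ∀ b, 𝒱.Fiber b} {l : Filter B} :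
    Tendsto (fun b ↦ β.ip (ξ b) (ξ b)) l (𝓝 0) ↔ Tendsto (fun b ↦ β.len (ξ b)) l (𝓝 0) := by
  rw [tendsto_zero_iff_norm_tendsto_zero]
  constructor <;> intro h
  · simpa [len] using h.sqrt
  · simpa [len_sq] using h.pow 2

/-- A uniform limit of continuous sections is continuous. -/
theorem continuous_sec_of_uniform_limit {ξ : ∀ b, 𝒱.Fiber b}
    (h : ∀ ε > 0, ∃ η : ∀ b, 𝒱.Fiber b, Continuous (sec η) ∧ ∀ x, β.len (η x - ξ x) ≤ ε) :
    Continuous (sec ξ) := by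
  refine continuous_iff_continuousAt.2 fun b ↦ ?_
  obtain ⟨n, e, -, hb, hlin⟩ := 𝒱.locally_trivial b
  refine (continuousAt_sec_iff e hb ξ).2 ?_
  obtain ⟨C, hC, hCle⟩ := β.exists_norm_trivialization_le e hb hlin
  refine Metric.continuousAt_iff'.2 fun ε hε ↦ ?_
  -- In coordinates `η` is then within `ε / 4` of `ξ` both at `x` and at `b`, which leaves `ε / 2`
  -- for the variation of `η`.
  obtain ⟨η, hη, hle⟩ := h (ε / (4 * C)) (by positivity)
  have hη' := Metric.continuousAt_iff'.1 ((continuousAt_sec_iff e hb η).1 hη.continuousAt)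
    (ε / 2) (by positivity)
  have key : ∀ᶠ x in 𝓝 b, dist (e (sec ξ x)).2 (e (sec η x)).2 ≤ ε / 4 := by
    filter_upwards [hCle, e.open_baseSet.mem_nhds hb] with x hx hxe
    rw [dist_comm, dist_eq_norm]
    have hsub : (e (sec η x)).2 - (e (sec ξ x)).2 = (e ⟨x, η x - ξ x⟩).2 :=
      ((hlin x hxe).map_sub (η x) (ξ x)).symm
    rw [hsub]
    calc _ ≤ C * β.len (η x - ξ x) := hx _
      _ ≤ C * (ε / (4 * C)) := by gcongr; exact hle x
      _ = ε / 4 := by field_simp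
  filter_upwards [hη', key] with x hx hx'
  have hb' := key.self_of_nhds
  calc _ ≤ dist (e (sec ξ x)).2 (e (sec η x)).2 + dist (e (sec η x)).2 (e (sec η b)).2
        + dist (e (sec η b)).2 (e (sec ξ b)).2 := dist_triangle4 _ _ _ _
    _ < ε / 4 + ε / 2 + ε / 4 := by rw [dist_comm (e (sec η b)).2]; linarith
    _ = ε := by ring

/-- The limit exists pointwise by completeness of the fibres; the uniform Cauchy bound passes to it,
so continuity and decay are inherited. -/
theorem exists_section_limit (u : ℕ → β.sections)
    (hu : ∀ ε > 0, ∃ N, ∀ m ≥ N, ∀ n ≥ N, ∀ x, β.len ((u m).1 x - (u n).1 x) ≤ ε) :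
    ∃ ξ : β.sections, ∀ ε > 0, ∃ N, ∀ n ≥ N, ∀ x, β.len ((u n).1 x - ξ.1 x) ≤ ε := by
  have hpt : ∀ x, ∃ v, ∀ ε > 0, ∃ N, ∀ n ≥ N, β.len ((u n).1 x - v) < ε := fun x ↦
    β.exists_tendsto_of_cauchy (fun n ↦ (u n).1 x) fun ε hε ↦ by
      obtain ⟨N, hN⟩ := hu (ε / 2) (half_pos hε)
      exact ⟨N, fun m hm n hn ↦ (hN m hm n hn x).trans_lt (half_lt_self hε)⟩
  choose ξ hξ using hpt
  have hlim : ∀ ε > 0, ∃ N, ∀ n ≥ N, ∀ x, β.len ((u n).1 x - ξ x) ≤ ε := by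
    intro ε hε
    obtain ⟨N, hN⟩ := hu ε hε
    -- The index `M` may depend on `x`, but it is only used for an intermediate term; `N` does not.
    refine ⟨N, fun n hn x ↦ le_of_forall_pos_le_add fun δ hδ ↦ ?_⟩
    obtain ⟨M, hM⟩ := hξ x δ hδ
    calc _ ≤ _ := β.len_sub_le_add _ ((u (max M N)).1 x) _
      _ ≤ ε + δ := add_le_add (hN n hn _ (le_max_right _ _) x) (hM _ (le_max_left _ _)).le
  refine ⟨⟨ξ, β.continuous_sec_of_uniform_limit fun ε hε ↦ ?_, ?_⟩, hlim⟩
  · obtain ⟨N, hN⟩ := hlim ε hε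
    exact ⟨(u N).1, (u N).2.1, hN N le_rfl⟩
  · rw [tendsto_ip_self_iff, Metric.tendsto_nhds]
    intro ε hε
    obtain ⟨N, hN⟩ := hlim (ε / 2) (half_pos hε)
    have h := (β.tendsto_ip_self_iff.1 (u N).2.2).eventually (gt_mem_nhds (half_pos hε))
    filter_upwards [h] with x hx
    rw [Real.dist_0_eq_abs, abs_of_nonneg (β.len_nonneg _)]
    have h1 := β.len_add_le (ξ x - (u N).1 x) ((u N).1 x)
    rw [sub_add_cancel, len_sub_rev] at h1
    linarith [hN N le_rfl x]

/-- The left and right module norms are both the supremum of the fibre lengths, so one argument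
serves both. Phrasing this through upper bounds `C` avoids suprema. -/
theorem isModuleComplete_of_moduleNorm_le_iff {A : Type*} [NonUnitalCStarAlgebra A]
    {ip : β.sections → β.sections → A}
    (h : ∀ ξ C, 0 ≤ C → (moduleNorm ip ξ ≤ C ↔ ∀ x, β.len (ξ.1 x) ≤ C)) :
    IsModuleComplete ip := by
  intro u hu
  obtain ⟨ξ, hξ⟩ := β.exists_section_limit u fun ε hε ↦ by
    obtain ⟨N, hN⟩ := hu ε hε
    exact ⟨N, fun m hm n hn ↦ (h _ ε hε.le).1 (hN m hm n hn).le⟩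
  refine ⟨ξ, fun ε hε ↦ ?_⟩
  obtain ⟨N, hN⟩ := hξ (ε / 2) (half_pos hε)
  exact ⟨N, fun n hn ↦
    ((h (u n - ξ) _ (half_pos hε).le).2 (hN n hn)).trans_lt (half_lt_self hε)⟩

/-! ### Line bundles -/

/-- Both `u` and `w` are multiples of a single vector, and the expression is symmetric in the two
coefficients. -/
theorem ip_smul_eq_ip_smul_of_finrank_eq_one {b : B}
    (h : Module.finrank ℂ (𝒱.Fiber b) = 1) (u v w : 𝒱.Fiber b) :
    β.ip v w • u = β.ip v u • w := by
  obtain ⟨v₀, -, h₀⟩ := finrank_eq_one_iff'.1 h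
  obtain ⟨a, rfl⟩ := h₀ u
  obtain ⟨c, rfl⟩ := h₀ w
  rw [ip_smul_right, ip_smul_right, smul_smul, smul_smul]
  ring_nf

theorem exists_len_eq_one (b : B) : ∃ v : 𝒱.Fiber b, β.len v = 1 := by
  have := nontrivial_fiber (𝒱 := 𝒱) b
  obtain ⟨v, hv⟩ := exists_ne (0 : 𝒱.Fiber b)
  have hpos : 0 < β.len v := (β.len_nonneg v).lt_of_ne' fun h ↦ hv (β.len_eq_zero.1 h)
  refine ⟨(((β.len v)⁻¹ : ℝ) : ℂ) • v, ?_⟩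
  rw [len_smul, Complex.norm_real, Real.norm_of_nonneg (inv_pos.2 hpos).le,
    inv_mul_cancel₀ (ne_of_gt hpos)]

/-- If for all vectors `v`, `w` the operator `z ↦ β(v, z) w` is a scalar, then the fibre is
one-dimensional. -/
theorem finrank_eq_one_of_forall_ip_smul_eq {b : B}
    (h : ∀ v w : 𝒱.Fiber b, ∃ c : ℂ, ∀ z, β.ip v z • w = c • z) :
    Module.finrank ℂ (𝒱.Fiber b) = 1 := by
  obtain ⟨v, hv⟩ := β.exists_len_eq_one b
  have hvv : β.ip v v = 1 := by rw [ip_self_eq, hv]; simp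
  refine finrank_eq_one_iff'.2 ⟨v, ?_, fun w ↦ ?_⟩
  · rintro rfl
    rw [β.len_eq_zero.2 rfl] at hv
    exact zero_ne_one hv
  · obtain ⟨c, hc⟩ := h v w
    exact ⟨c, by rw [← hc v, hvv, one_smul]⟩

/-- Finitely many sections without common zero on a compact set. -/
theorem exists_finset_sections_pos [T2Space B] [LocallyCompactSpace B] {K : Set B}
    (hK : IsCompact K) : ∃ (t : Finset β.sections) (δ : ℝ), 0 < δ ∧
      ∀ x ∈ K, δ ≤ ∑ s ∈ t, β.len (s.1 x) ^ 2 := by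
  classical
  have hex : ∀ x, ∃ s : β.sections, β.len (s.1 x) = 1 := fun x ↦ by
    obtain ⟨v, hv⟩ := β.exists_len_eq_one x
    obtain ⟨s, rfl⟩ := β.exists_section_eq x v
    exact ⟨s, hv⟩
  choose s hs using hex
  have hcont : ∀ ξ : β.sections, Continuous (fun y ↦ β.len (ξ.1 y)) :=
    fun ξ ↦ β.continuous_len ξ.2.1
  obtain ⟨t, -, ht⟩ := hK.elim_nhds_subcover (fun x ↦ {y | 0 < β.len ((s x).1 y)}) fun x _ ↦
    (isOpen_lt continuous_const (hcont (s x))).mem_nhds (by simp [hs x])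
  have hpos : ∀ y ∈ K, 0 < ∑ ξ ∈ t.image s, β.len (ξ.1 y) ^ 2 := by
    intro y hy
    obtain ⟨x, hx, hxy⟩ := Set.mem_iUnion₂.1 (ht hy)
    exact Finset.sum_pos' (fun _ _ ↦ sq_nonneg _)
      ⟨s x, Finset.mem_image_of_mem s hx, pow_pos hxy 2⟩
  obtain ⟨δ, hδ, hle⟩ := hK.exists_forall_le'
    (continuous_finsetSum _ fun ξ _ ↦ (hcont ξ).pow 2).continuousOn hpos
  exact ⟨t.image s, δ, hδ, hle⟩

end ComplexVectorBundle.HermitianMetric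

/-! ### Functions vanishing at infinity -/

section ZeroAtInfty

variable {X : Type*} [TopologicalSpace X]

theorem ZeroAtInftyContinuousMap.norm_le_iff (f : C₀(X, ℂ)) {C : ℝ} (hC : 0 ≤ C) :
    ‖f‖ ≤ C ↔ ∀ x, ‖f x‖ ≤ C := by
  rw [← ZeroAtInftyContinuousMap.norm_toBCF_eq_norm, BoundedContinuousFunction.norm_le hC]
  rfl

theorem ZeroAtInftyContinuousMap.norm_apply_le (f : C₀(X, ℂ)) (x : X) : ‖f x‖ ≤ ‖f‖ :=
  (f.norm_le_iff (norm_nonneg f)).1 le_rfl x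

/-- A nonnegative function in `C₀(X)` has a square root. -/
theorem exists_eq_star_mul_self (f : C₀(X, ℂ)) (hf : ∀ x, f x = (‖f x‖ : ℂ)) :
    ∃ a : C₀(X, ℂ), f = star a * a := by
  refine ⟨⟨⟨fun x ↦ ((√‖f x‖ : ℝ) : ℂ), ?_⟩, ?_⟩, ?_⟩
  · exact Complex.continuous_ofReal.comp f.continuous.norm.sqrt
  · have h := (tendsto_zero_iff_norm_tendsto_zero.1 f.zero_at_infty').sqrt
    rw [Real.sqrt_zero] at h
    simpa [Function.comp_def] using (Complex.continuous_ofReal.tendsto 0).comp h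
  · ext x
    rw [hf x]
    change _ = star ((√‖f x‖ : ℝ) : ℂ) * ((√‖f x‖ : ℝ) : ℂ)
    rw [Complex.star_def, Complex.conj_ofReal, ← Complex.ofReal_mul,
      Real.mul_self_sqrt (norm_nonneg _)]

theorem isCompact_le_norm (f : C₀(X, ℂ)) {ε : ℝ} (hε : 0 < ε) :
    IsCompact {x | ε ≤ ‖f x‖} := by
  have h := (tendsto_zero_iff_norm_tendsto_zero.1 f.zero_at_infty').eventually (gt_mem_nhds hε)
  obtain ⟨K, hK, hsub⟩ := mem_cocompact.1 h
  refine hK.of_isClosed_subset (isClosed_le continuous_const f.continuous.norm) fun x hx ↦ ?_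
  by_contra hxK
  have hlt : ‖f x‖ < ε := hsub hxK
  exact not_lt.2 hx hlt

/-- Two functions in `C₀(X)` agree if they agree on `W` and vanish outside `W`. -/
theorem ext_of_open (W : Opens X) {f g : C₀(X, ℂ)} (h : ∀ x : W, f x = g x)
    (hf : ∀ x ∉ W, f x = 0) (hg : ∀ x ∉ W, g x = 0) : f = g := by
  ext x
  by_cases hx : x ∈ W
  · exact h ⟨x, hx⟩
  · rw [hf x hx, hg x hx]

variable [T2Space X] (W : Opens X)

theorem extendZero_apply_coe (g : C₀(W, ℂ)) (x : W) : extendZero W g x = g x := by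
  change zeroExtension W g x = g x
  simp [zeroExtension]

theorem extendZero_apply_of_notMem (g : C₀(W, ℂ)) {x : X} (hx : x ∉ W) :
    extendZero W g x = 0 := by
  change zeroExtension W g x = 0
  simp [zeroExtension, hx]

theorem norm_extendZero_le_iff (g : C₀(W, ℂ)) {C : ℝ} (hC : 0 ≤ C) :
    ‖extendZero W g‖ ≤ C ↔ ∀ x, ‖g x‖ ≤ C := by
  rw [ZeroAtInftyContinuousMap.norm_le_iff _ hC]
  constructor
  · intro h x
    rw [← extendZero_apply_coe]
    exact h x
  · intro h x
    by_cases hx : x ∈ W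
    · rw [extendZero_apply_coe W g ⟨x, hx⟩]
      exact h _
    · rw [extendZero_apply_of_notMem W g hx]
      simpa using hC

end ZeroAtInfty

namespace Correspondence

open ComplexVectorBundle

variable {X : Type*} [TopologicalSpace X] {U V : Opens X} {𝒱 : ComplexVectorBundle U}

theorem rightMul_apply (β : 𝒱.HermitianMetric) (ξ : β.sections) (f : C₀(X, ℂ)) (x : U) :
    (rightMul β ξ f).1 x = f x • ξ.1 x := rfl

theorem structureMap_apply (θ : U ≃ₜ V) (β : 𝒱.HermitianMetric) (f : C₀(X, ℂ))
    (ξ : β.sections) (x : U) : (structureMap θ β f ξ).1 x = f (θ x) • ξ.1 x := rfl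

theorem leftMul_apply (θ : U ≃ₜ V) (β : 𝒱.HermitianMetric) (f : C₀(X, ℂ))
    (ξ : β.sections) (x : U) : (leftMul θ β f ξ).1 x = f (θ x) • ξ.1 x := rfl

/-- Vanishing outside `V` forces the compact set `{ε ≤ |f|}` of `X` to lie inside `V`, where `θ` can
pull it back. -/
theorem isCompact_le_norm_comp (θ : U ≃ₜ V) {f : C₀(X, ℂ)} (hf : f ∈ idealOfOpen V) {ε : ℝ}
    (hε : 0 < ε) : IsCompact {t : U | ε ≤ ‖f (θ t)‖} := by
  have hV : IsCompact {t : V | ε ≤ ‖f t‖} := by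
    refine Topology.IsInducing.subtypeVal.isCompact_iff.2 ?_
    convert isCompact_le_norm f hε using 1
    ext x
    constructor
    · rintro ⟨y, hy, rfl⟩
      exact hy
    · intro hx
      have hxV : x ∈ V := by
        by_contra hxV
        have h0 : ε ≤ ‖f x‖ := hx
        rw [hf x hxV, norm_zero] at h0
        exact absurd h0 (not_le.2 hε)
      exact ⟨⟨x, hxV⟩, hx, rfl⟩
  exact θ.isCompact_preimage.2 hV

variable [T2Space X]

/-! ### The inner products -/

theorem rightInner_apply_coe (β : 𝒱.HermitianMetric) (ξ η : β.sections) (x : U) :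
    rightInner β ξ η x = β.ip (ξ.1 x) (η.1 x) := extendZero_apply_coe U _ x

theorem rightInner_apply_of_notMem (β : 𝒱.HermitianMetric) (ξ η : β.sections) {x : X}
    (hx : x ∉ U) : rightInner β ξ η x = 0 := extendZero_apply_of_notMem U _ hx

theorem leftInner_apply (θ : U ≃ₜ V) (β : 𝒱.HermitianMetric) (ξ η : β.sections) (x : U) :
    leftInner θ β ξ η (θ x) = β.ip (η.1 x) (ξ.1 x) := by
  have h : leftInner θ β ξ η (θ x) =
      β.ip (η.1 (θ.symm (θ x))) (ξ.1 (θ.symm (θ x))) := extendZero_apply_coe V _ (θ x)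
  rw [h, θ.symm_apply_apply]

theorem leftInner_apply_of_notMem (θ : U ≃ₜ V) (β : 𝒱.HermitianMetric) (ξ η : β.sections)
    {x : X} (hx : x ∉ V) : leftInner θ β ξ η x = 0 := extendZero_apply_of_notMem V _ hx

theorem moduleNorm_rightInner_le_iff (β : 𝒱.HermitianMetric) (ξ : β.sections) (C : ℝ)
    (hC : 0 ≤ C) : moduleNorm (rightInner β) ξ ≤ C ↔ ∀ x, β.len (ξ.1 x) ≤ C := by
  rw [moduleNorm, Real.sqrt_le_left hC, rightInner, norm_extendZero_le_iff U _ (sq_nonneg C)]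
  refine forall_congr' fun x ↦ ?_
  rw [HermitianMetric.len, Real.sqrt_le_left hC]
  rfl

theorem moduleNorm_leftInner_le_iff (θ : U ≃ₜ V) (β : 𝒱.HermitianMetric) (ξ : β.sections)
    (C : ℝ) (hC : 0 ≤ C) :
    moduleNorm (leftInner θ β) ξ ≤ C ↔ ∀ x, β.len (ξ.1 x) ≤ C := by
  rw [moduleNorm, Real.sqrt_le_left hC, leftInner, norm_extendZero_le_iff V _ (sq_nonneg C),
    θ.symm.forall_congr_left]
  refine forall_congr' fun x ↦ ?_
  rw [HermitianMetric.len, Real.sqrt_le_left hC]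
  change ‖β.ip (ξ.1 (θ.symm (θ x))) (ξ.1 (θ.symm (θ x)))‖ ≤ _ ↔ _
  rw [θ.symm_apply_apply]

theorem len_le_moduleNorm (β : 𝒱.HermitianMetric) (ξ : β.sections) (x : U) :
    β.len (ξ.1 x) ≤ moduleNorm (rightInner β) ξ :=
  (moduleNorm_rightInner_le_iff β ξ _ (Real.sqrt_nonneg _)).1 le_rfl x

theorem isRightHilbertModule (β : 𝒱.HermitianMetric) :
    IsRightHilbertModule (rightMul β) (rightInner β) where
  ract_add x a b := Subtype.ext <| funext fun t ↦ add_smul (a t) (b t) (x.1 t)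
  add_ract x y a := Subtype.ext <| funext fun t ↦ smul_add (a t) (x.1 t) (y.1 t)
  ract_mul x a b := Subtype.ext <| funext fun t ↦ by
    simp only [rightMul_apply, ZeroAtInftyContinuousMap.mul_apply, smul_smul, mul_comm]
  ract_smul c x a := Subtype.ext <| funext fun t ↦ smul_assoc c (a t) (x.1 t)
  smul_ract c x a := Subtype.ext <| funext fun t ↦ smul_comm (a t) c (x.1 t)
  ip_add x y z := ext_of_open U
    (fun t ↦ by
      simp only [rightInner_apply_coe, ZeroAtInftyContinuousMap.add_apply]
      exact β.ip_add_right _ _ _)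
    (fun t ht ↦ rightInner_apply_of_notMem β _ _ ht)
    (fun t ht ↦ by simp [rightInner_apply_of_notMem β _ _ ht])
  ip_smul c x y := ext_of_open U
    (fun t ↦ by
      simp only [rightInner_apply_coe, ZeroAtInftyContinuousMap.smul_apply]
      exact β.ip_smul_right _ _ _)
    (fun t ht ↦ rightInner_apply_of_notMem β _ _ ht)
    (fun t ht ↦ by simp [rightInner_apply_of_notMem β _ _ ht])
  ip_ract x y a := ext_of_open U
    (fun t ↦ by
      simp only [rightInner_apply_coe, ZeroAtInftyContinuousMap.mul_apply, rightMul_apply]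
      rw [β.ip_smul_right, mul_comm])
    (fun t ht ↦ rightInner_apply_of_notMem β _ _ ht)
    (fun t ht ↦ by simp [rightInner_apply_of_notMem β _ _ ht])
  star_ip x y := ext_of_open U
    (fun t ↦ by
      simp only [rightInner_apply_coe, ZeroAtInftyContinuousMap.star_apply]
      exact β.star_ip _ _)
    (fun t ht ↦ by simp [rightInner_apply_of_notMem β _ _ ht])
    (fun t ht ↦ rightInner_apply_of_notMem β _ _ ht)
  ip_self_nonneg x := exists_eq_star_mul_self _ fun t ↦ by
    by_cases ht : t ∈ U
    · rw [rightInner_apply_coe β x x ⟨t, ht⟩, ← β.len_sq, β.ip_self_eq]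
    · simp [rightInner_apply_of_notMem β _ _ ht]
  ip_definite x hx := Subtype.ext <| funext fun t ↦ β.ip_self_eq_zero.1 <| by
    rw [← rightInner_apply_coe, hx]
    rfl
  complete := β.isModuleComplete_of_moduleNorm_le_iff (moduleNorm_rightInner_le_iff β)

theorem isLeftHilbertModule (θ : U ≃ₜ V) (β : 𝒱.HermitianMetric) :
    IsLeftHilbertModule (leftMul θ β) (leftInner θ β) := by
  have hext : ∀ {f g : C₀(X, ℂ)}, (∀ x : U, f (θ x) = g (θ x)) →
      (∀ x ∉ V, f x = 0) → (∀ x ∉ V, g x = 0) → f = g := fun h hf hg ↦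
    ext_of_open V (fun x ↦ by simpa using h (θ.symm x)) hf hg
  exact {
    add_lact := fun a b x ↦ Subtype.ext <| funext fun t ↦ add_smul (a (θ t)) (b (θ t)) (x.1 t)
    lact_add := fun a x y ↦ Subtype.ext <| funext fun t ↦ smul_add (a (θ t)) (x.1 t) (y.1 t)
    mul_lact := fun a b x ↦ Subtype.ext <| funext fun t ↦ by
      simp only [leftMul_apply, ZeroAtInftyContinuousMap.mul_apply, smul_smul]
    smul_lact := fun c a x ↦ Subtype.ext <| funext fun t ↦ smul_assoc c (a (θ t)) (x.1 t)
    lact_smul := fun c a x ↦ Subtype.ext <| funext fun t ↦ smul_comm (a (θ t)) c (x.1 t)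
    add_ip := fun x y z ↦ hext
      (fun t ↦ by
        simp only [leftInner_apply, ZeroAtInftyContinuousMap.add_apply]
        exact β.ip_add_right _ _ _)
      (fun t ht ↦ leftInner_apply_of_notMem θ β _ _ ht)
      (fun t ht ↦ by simp [leftInner_apply_of_notMem θ β _ _ ht])
    smul_ip := fun c x y ↦ hext
      (fun t ↦ by
        simp only [leftInner_apply, ZeroAtInftyContinuousMap.smul_apply]
        exact β.ip_smul_right _ _ _)
      (fun t ht ↦ leftInner_apply_of_notMem θ β _ _ ht)
      (fun t ht ↦ by simp [leftInner_apply_of_notMem θ β _ _ ht])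
    lact_ip := fun a x y ↦ hext
      (fun t ↦ by
        simp only [leftInner_apply, ZeroAtInftyContinuousMap.mul_apply, leftMul_apply]
        exact β.ip_smul_right _ _ _)
      (fun t ht ↦ leftInner_apply_of_notMem θ β _ _ ht)
      (fun t ht ↦ by simp [leftInner_apply_of_notMem θ β _ _ ht])
    star_ip := fun x y ↦ hext
      (fun t ↦ by
        simp only [leftInner_apply, ZeroAtInftyContinuousMap.star_apply]
        exact β.star_ip _ _)
      (fun t ht ↦ by simp [leftInner_apply_of_notMem θ β _ _ ht])
      (fun t ht ↦ leftInner_apply_of_notMem θ β _ _ ht)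
    ip_self_nonneg := fun x ↦ exists_eq_star_mul_self _ fun t ↦ by
      by_cases ht : t ∈ V
      · obtain ⟨s, hs⟩ := θ.surjective ⟨t, ht⟩
        obtain rfl : (θ s : X) = t := congrArg Subtype.val hs
        rw [leftInner_apply, ← β.len_sq, β.ip_self_eq]
      · simp [leftInner_apply_of_notMem θ β _ _ ht]
    ip_definite := fun x hx ↦ Subtype.ext <| funext fun t ↦ β.ip_self_eq_zero.1 <| by
      rw [← leftInner_apply θ, hx]
      rfl
    complete := β.isModuleComplete_of_moduleNorm_le_iff (moduleNorm_leftInner_le_iff θ β) }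

/-- Only `compat` needs rank one; the module axioms on each side hold for every bundle. -/
theorem isHilbertBimodule_of_isLineBundle (θ : U ≃ₜ V) (β : 𝒱.HermitianMetric)
    (h : 𝒱.IsLineBundle) :
    IsHilbertBimodule (leftMul θ β) (leftInner θ β) (rightMul β) (rightInner β) where
  right := isRightHilbertModule β
  left := isLeftHilbertModule θ β
  assoc a x b := Subtype.ext <| funext fun t ↦ smul_comm (a (θ t)) (b t) (x.1 t)
  compat x y z := Subtype.ext <| funext fun t ↦ by
    rw [leftMul_apply, leftInner_apply, rightMul_apply, rightInner_apply_coe]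
    exact β.ip_smul_eq_ip_smul_of_finrank_eq_one (h t) _ _ _

/-! ### Rank-one operators -/

/-- The operator `z ↦ x ⟨y, z⟩`. -/
noncomputable def rankOne (β : 𝒱.HermitianMetric) (x y : β.sections) : β.sections →ₗ[ℂ] β.sections where
  toFun z := rightMul β x (rightInner β y z)
  map_add' z w := by
    rw [(isRightHilbertModule β).ip_add, (isRightHilbertModule β).ract_add]
  map_smul' c z := by
    rw [(isRightHilbertModule β).ip_smul, (isRightHilbertModule β).ract_smul, RingHom.id_apply]

theorem rankOne_apply (β : 𝒱.HermitianMetric) (x y z : β.sections) (t : U) :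
    (rankOne β x y z).1 t = β.ip (y.1 t) (z.1 t) • x.1 t := by
  change (rightMul β x (rightInner β y z)).1 t = _
  rw [rightMul_apply, rightInner_apply_coe]

theorem isAdjointable_of_forall_ip_eq (β : 𝒱.HermitianMetric)
    {T S : β.sections →ₗ[ℂ] β.sections}
    (h : ∀ x y t, β.ip ((T x).1 t) (y.1 t) = β.ip (x.1 t) ((S y).1 t)) :
    IsAdjointable (rightInner β) T :=
  ⟨S, fun x y ↦ ext_of_open U
    (fun t ↦ by rw [rightInner_apply_coe, rightInner_apply_coe]; exact h x y t)
    (fun _ ht ↦ rightInner_apply_of_notMem β _ _ ht)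
    (fun _ ht ↦ rightInner_apply_of_notMem β _ _ ht)⟩

theorem rankOne_mem_compactOperators (β : 𝒱.HermitianMetric) (x y : β.sections) :
    rankOne β x y ∈ compactOperators (rightMul β) (rightInner β) := by
  refine ⟨isAdjointable_of_forall_ip_eq β (S := rankOne β y x) fun z w t ↦ ?_,
    fun ε hε ↦ ⟨rankOne β x y, Submodule.subset_span ⟨x, y, fun _ ↦ rfl⟩, fun z ↦ ?_⟩⟩
  · rw [rankOne_apply, rankOne_apply, β.ip_smul_left, β.ip_smul_right, β.star_ip, mul_comm]
  · have h0 := Real.sqrt_nonneg ‖rightInner β z z‖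
    refine (moduleNorm_rightInner_le_iff β _ _ (mul_nonneg hε.le h0)).2 fun t ↦ ?_
    rw [sub_self]
    refine (β.len_eq_zero.2 rfl).trans_le (mul_nonneg hε.le h0)

/-- If every rank-one operator is multiplication by a function, then `𝒱` is a line bundle. -/
theorem isLineBundle_of_rankOne_eq_structureMap [LocallyCompactSpace X] (θ : U ≃ₜ V)
    (β : 𝒱.HermitianMetric)
    (h : ∀ x y : β.sections, ∃ f : C₀(X, ℂ), ∀ z, structureMap θ β f z = rankOne β x y z) :
    𝒱.IsLineBundle := by
  have : LocallyCompactSpace U := U.isOpen.locallyCompactSpace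
  refine fun b ↦ β.finrank_eq_one_of_forall_ip_smul_eq fun v w ↦ ?_
  obtain ⟨x, rfl⟩ := β.exists_section_eq b w
  obtain ⟨y, rfl⟩ := β.exists_section_eq b v
  obtain ⟨f, hf⟩ := h x y
  refine ⟨f (θ b), fun z ↦ ?_⟩
  obtain ⟨z, rfl⟩ := β.exists_section_eq b z
  rw [← rankOne_apply, ← hf, structureMap_apply]

/-! ### Compact operators on the sections of a line bundle -/

theorem exists_eq_mul_of_mem_span (β : 𝒱.HermitianMetric) (h : 𝒱.IsLineBundle)
    {F : β.sections →ₗ[ℂ] β.sections}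
    (hF : F ∈ Submodule.span ℂ {R : β.sections →ₗ[ℂ] β.sections |
      ∃ x y, ∀ z, R z = rightMul β x (rightInner β y z)}) :
    ∃ g : C₀(U, ℂ), ∀ z t, (F z).1 t = g t • z.1 t := by
  induction hF using Submodule.span_induction with
  | mem R hR =>
    obtain ⟨x, y, hR⟩ := hR
    refine ⟨β.baseInner y x, fun z t ↦ ?_⟩
    rw [hR, rightMul_apply, rightInner_apply_coe]
    exact β.ip_smul_eq_ip_smul_of_finrank_eq_one (h t) _ _ _
  | zero => exact ⟨0, fun z t ↦ (zero_smul ℂ (z.1 t)).symm⟩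
  | add F G _ _ hF hG =>
    obtain ⟨f, hf⟩ := hF
    obtain ⟨g, hg⟩ := hG
    refine ⟨f + g, fun z t ↦ ?_⟩
    rw [ZeroAtInftyContinuousMap.add_apply, add_smul, ← hf, ← hg]
    rfl
  | smul c F _ hF =>
    obtain ⟨f, hf⟩ := hF
    refine ⟨c • f, fun z t ↦ ?_⟩
    rw [ZeroAtInftyContinuousMap.smul_apply, smul_assoc, ← hf]
    rfl

/-- Finite-rank approximants of `T` are multiplications by functions `g ε`. Testing at each `t` on a
section of the unit ball with length one at `t` shows that these are uniformly Cauchy; their limit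
is the multiplier of `T`. -/
theorem exists_eq_mul_of_mem_compactOperators [LocallyCompactSpace X] (β : 𝒱.HermitianMetric)
    (h : 𝒱.IsLineBundle) {T : β.sections →ₗ[ℂ] β.sections}
    (hT : T ∈ compactOperators (rightMul β) (rightInner β)) :
    ∃ g : C₀(U, ℂ), ∀ z t, (T z).1 t = g t • z.1 t := by
  have : LocallyCompactSpace U := U.isOpen.locallyCompactSpace
  have happ : ∀ ε > 0, ∃ g : C₀(U, ℂ), ∀ z t,
      β.len ((T z).1 t - g t • z.1 t) ≤ ε * moduleNorm (rightInner β) z := by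
    intro ε hε
    obtain ⟨F, hF, hle⟩ := hT.2 ε hε
    obtain ⟨g, hg⟩ := exists_eq_mul_of_mem_span β h hF
    refine ⟨g, fun z t ↦ ?_⟩
    rw [← hg]
    exact (len_le_moduleNorm β (T z - F z) t).trans (hle z)
  choose! g hg using happ
  have hdist : ∀ ε > 0, ∀ δ > 0, dist (g ε) (g δ) ≤ ε + δ := by
    intro ε hε δ hδ
    rw [dist_eq_norm, ZeroAtInftyContinuousMap.norm_le_iff _ (by positivity)]
    intro t
    obtain ⟨v, hv⟩ := β.exists_len_eq_one t
    obtain ⟨z, rfl, hz⟩ := β.exists_section_eq_le_one t v hv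
    have hz1 := (moduleNorm_rightInner_le_iff β z 1 zero_le_one).2 hz
    have h1 := (hg ε hε z t).trans (mul_le_of_le_one_right hε.le hz1)
    have h2 := (hg δ hδ z t).trans (mul_le_of_le_one_right hδ.le hz1)
    have h3 := β.len_sub_le_add (g ε t • z.1 t) ((T z).1 t) (g δ t • z.1 t)
    rw [← sub_smul, β.len_smul, hv, mul_one, β.len_sub_rev] at h3
    exact h3.trans (add_le_add h1 h2)
  let r : ℕ → ℝ := fun n ↦ 1 / ((n : ℝ) + 1)
  have hr : ∀ n, 0 < r n := fun n ↦ Nat.one_div_pos_of_nat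
  have hr0 : Tendsto r atTop (𝓝 0) := tendsto_one_div_add_atTop_nhds_zero_nat
  have hcau : CauchySeq fun n ↦ g (r n) := by
    refine cauchySeq_of_le_tendsto_0 (fun n ↦ 2 * r n) (fun n m N hn hm ↦ ?_)
      (by simpa using hr0.const_mul 2)
    have h1 : r n ≤ r N := Nat.one_div_le_one_div hn
    have h2 : r m ≤ r N := Nat.one_div_le_one_div hm
    linarith [hdist _ (hr n) _ (hr m)]
  obtain ⟨g₀, hg₀⟩ := cauchySeq_tendsto_of_complete hcau
  refine ⟨g₀, fun z t ↦ sub_eq_zero.1 (β.len_eq_zero.1 (le_antisymm ?_ (β.len_nonneg _)))⟩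
  have hlim : Tendsto (fun n ↦ r n * moduleNorm (rightInner β) z
      + dist (g (r n)) g₀ * β.len (z.1 t)) atTop (𝓝 0) := by
    simpa using (hr0.mul_const _).add ((tendsto_iff_dist_tendsto_zero.1 hg₀).mul_const _)
  refine ge_of_tendsto' hlim fun n ↦ ?_
  refine (β.len_sub_le_add _ (g (r n) t • z.1 t) _).trans (add_le_add (hg _ (hr n) z t) ?_)
  rw [← sub_smul, β.len_smul]
  refine mul_le_mul_of_nonneg_right ?_ (β.len_nonneg _)
  rw [dist_eq_norm]
  exact (g (r n) - g₀).norm_apply_le t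

/-- On a line, `β(ξ, z) ξ = |ξ|² z`, so the sections in `s` act together like an unnormalized frame.
-/
theorem sum_rankOne_mulSection_apply (β : 𝒱.HermitianMetric) (h : 𝒱.IsLineBundle)
    (k : BoundedContinuousFunction U ℂ) (s : Finset β.sections) (z : β.sections) (t : U) :
    ((∑ ξ ∈ s, rankOne β (β.mulSection k ξ) ξ) z).1 t
      = (k t * ((∑ ξ ∈ s, β.len (ξ.1 t) ^ 2 : ℝ) : ℂ)) • z.1 t := by
  rw [LinearMap.sum_apply, AddSubmonoidClass.coe_finsetSum, Finset.sum_apply]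
  push_cast
  rw [Finset.mul_sum, Finset.sum_smul]
  refine Finset.sum_congr rfl fun ξ _ ↦ ?_
  have e1 : (β.mulSection k ξ).1 t = k t • ξ.1 t := rfl
  rw [rankOne_apply, e1, smul_comm, β.ip_smul_eq_ip_smul_of_finrank_eq_one (h t),
    β.ip_self_eq, smul_smul, Complex.ofReal_pow]

/-- With `H = ∑ |ξ|²`, the multiplier `f ∘ θ` is approximated by `(f ∘ θ) H / (H + τ)`, which comes
from a finite-rank operator. The error is `(f ∘ θ) τ / (H + τ)`: where `|f ∘ θ| ≥ ε` it is small
because `H ≥ δ`, and elsewhere it is at most `|f ∘ θ| < ε`. -/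
theorem structureMap_mem_compactOperators [LocallyCompactSpace X] (θ : U ≃ₜ V)
    (β : 𝒱.HermitianMetric) (h : 𝒱.IsLineBundle) {f : C₀(X, ℂ)} (hf : f ∈ idealOfOpen V) :
    structureMap θ β f ∈ compactOperators (rightMul β) (rightInner β) := by
  have : LocallyCompactSpace U := U.isOpen.locallyCompactSpace
  refine ⟨isAdjointable_of_forall_ip_eq β (S := structureMap θ β (star f)) fun z w t ↦ ?_,
    fun ε hε ↦ ?_⟩
  · rw [structureMap_apply, structureMap_apply, β.ip_smul_left, β.ip_smul_right]
    rfl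
  have hK : IsCompact {t : U | ε ≤ ‖f (θ t)‖} := isCompact_le_norm_comp θ hf hε
  obtain ⟨s, δ, hδ, hδs⟩ := β.exists_finset_sections_pos hK
  let H : U → ℝ := fun t ↦ ∑ ξ ∈ s, β.len (ξ.1 t) ^ 2
  have hH0 : ∀ t, 0 ≤ H t := fun t ↦ Finset.sum_nonneg fun _ _ ↦ sq_nonneg _
  have hHc : Continuous H :=
    continuous_finsetSum _ fun ξ _ ↦ (β.continuous_len ξ.2.1).pow 2
  -- The positive `τ` keeps the denominator nonzero where all chosen sections vanish; the `+ 1`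
  -- below allows `f = 0`.
  obtain ⟨τ, hτ, hτle⟩ : ∃ τ > 0, ‖f‖ * τ ≤ ε * δ := by
    refine ⟨ε * δ / (‖f‖ + 1), by positivity, ?_⟩
    rw [mul_div_assoc', div_le_iff₀ (by positivity)]
    nlinarith [norm_nonneg f, mul_pos hε hδ]
  have hpos : ∀ t, 0 < H t + τ := fun t ↦ add_pos_of_nonneg_of_pos (hH0 t) hτ
  have hne : ∀ t, ((H t + τ : ℝ) : ℂ) ≠ 0 := fun t ↦ Complex.ofReal_ne_zero.2 (hpos t).ne'
  let k : BoundedContinuousFunction U ℂ := BoundedContinuousFunction.ofNormedAddCommGroup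
    (fun t ↦ f (θ t) / ((H t + τ : ℝ) : ℂ))
    ((f.continuous.comp (continuous_subtype_val.comp θ.continuous)).div
      (Complex.continuous_ofReal.comp (hHc.add continuous_const)) hne)
    (‖f‖ / τ) (fun t ↦ by
      rw [norm_div, Complex.norm_real, Real.norm_of_nonneg (hpos t).le]
      exact div_le_div₀ (norm_nonneg f) (f.norm_apply_le _) hτ (le_add_of_nonneg_left (hH0 t)))
  have hk : ∀ t, k t = f (θ t) / ((H t + τ : ℝ) : ℂ) := fun _ ↦ rfl
  refine ⟨∑ ξ ∈ s, rankOne β (β.mulSection k ξ) ξ,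
    Submodule.sum_mem _ fun ξ _ ↦ Submodule.subset_span ⟨_, _, fun _ ↦ rfl⟩, fun z ↦ ?_⟩
  refine (moduleNorm_rightInner_le_iff β _ _ (mul_nonneg hε.le (Real.sqrt_nonneg _))).2
    fun t ↦ ?_
  have hsum : _ = (k t * (H t : ℂ)) • z.1 t := sum_rankOne_mulSection_apply β h k s z t
  have hdiff : (structureMap θ β f z - (∑ ξ ∈ s, rankOne β (β.mulSection k ξ) ξ) z).1 t
      = (f (θ t) * ((τ / (H t + τ) : ℝ) : ℂ)) • z.1 t := by
    have e1 : (structureMap θ β f z - (∑ ξ ∈ s, rankOne β (β.mulSection k ξ) ξ) z).1 t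
      = (structureMap θ β f z).1 t - ((∑ ξ ∈ s, rankOne β (β.mulSection k ξ) ξ) z).1 t := rfl
    rw [e1, hsum, structureMap_apply, ← sub_smul, hk]
    congr 1
    have := hne t
    push_cast at this ⊢
    field_simp
    ring
  rw [hdiff, β.len_smul]
  refine mul_le_mul ?_ (len_le_moduleNorm β z t) (β.len_nonneg _) hε.le
  rw [norm_mul, Complex.norm_real, Real.norm_of_nonneg (div_nonneg hτ.le (hpos t).le)]
  by_cases ht : ε ≤ ‖f (θ t)‖
  · rw [mul_div_assoc', div_le_iff₀ (hpos t)]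
    calc ‖f (θ t)‖ * τ ≤ ‖f‖ * τ := by gcongr; exact f.norm_apply_le _
      _ ≤ ε * δ := hτle
      _ ≤ ε * (H t + τ) := by
        gcongr
        exact (hδs t ht).trans (le_add_of_nonneg_right hτ.le)
  · have hlt : ‖f (θ t)‖ < ε := not_le.1 ht
    refine (mul_le_of_le_one_right (norm_nonneg _) ?_).trans hlt.le
    exact div_le_one_of_le₀ (le_add_of_nonneg_left (hH0 t)) (hpos t).le

theorem image_structureMap_eq_compactOperators [LocallyCompactSpace X] (θ : U ≃ₜ V)
    (β : 𝒱.HermitianMetric) (h : 𝒱.IsLineBundle) :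
    structureMap θ β '' idealOfOpen V = compactOperators (rightMul β) (rightInner β) := by
  refine Set.Subset.antisymm ?_ fun T hT ↦ ?_
  · rintro _ ⟨f, hf, rfl⟩
    exact structureMap_mem_compactOperators θ β h hf
  · obtain ⟨g, hg⟩ := exists_eq_mul_of_mem_compactOperators β h hT
    refine ⟨extendZero V (g.comp θ.symm.toCocompactMap),
      fun x hx ↦ extendZero_apply_of_notMem V _ hx, ?_⟩
    refine LinearMap.ext fun z ↦ Subtype.ext <| funext fun t ↦ ?_
    rw [structureMap_apply, extendZero_apply_coe, hg]
    change g (θ.symm (θ t)) • z.1 t = _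
    rw [θ.symm_apply_apply]

end Correspondence

open Correspondence in
theorem mainTheorem8 {X : Type*} [TopologicalSpace X] [LocallyCompactSpace X] [T2Space X]
    [SecondCountableTopology X] (U V : Opens X) (θ : U ≃ₜ V)
    (𝒱 : ComplexVectorBundle U) (β : 𝒱.HermitianMetric) :
    (structureMap θ β '' idealOfOpen V = compactOperators (rightMul β) (rightInner β) ↔
      𝒱.IsLineBundle) ∧
    (IsHilbertBimodule (leftMul θ β) (leftInner θ β) (rightMul β) (rightInner β) ↔
      𝒱.IsLineBundle) ∧
    ((∃ lip : β.sections → β.sections → C₀(X, ℂ),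
        IsHilbertBimodule (leftMul θ β) lip (rightMul β) (rightInner β)) ↔
      𝒱.IsLineBundle) := by
  -- Compatibility says that the rank-one operator of `x`, `y` is the structure map at `lip x y`,
  -- whatever the left inner product is. This settles the forward direction of both 2 and 3.
  have hline : ∀ lip : β.sections → β.sections → C₀(X, ℂ),
      IsHilbertBimodule (leftMul θ β) lip (rightMul β) (rightInner β) → 𝒱.IsLineBundle :=
    fun lip h ↦ isLineBundle_of_rankOne_eq_structureMap θ β fun x y ↦
      ⟨lip x y, fun z ↦ h.compat x y z⟩
  refine ⟨⟨fun h ↦ ?_, image_structureMap_eq_compactOperators θ β⟩,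
    ⟨hline _, isHilbertBimodule_of_isLineBundle θ β⟩,
    fun ⟨lip, h⟩ ↦ hline lip h, fun h ↦ ⟨_, isHilbertBimodule_of_isLineBundle θ β h⟩⟩
  refine isLineBundle_of_rankOne_eq_structureMap θ β fun x y ↦ ?_
  obtain ⟨f, -, hf⟩ := h.symm ▸ rankOne_mem_compactOperators β x y
  exact ⟨f, fun z ↦ by rw [hf]⟩
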